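/- Let $n\ge 1$ and let $\mathbb{H}^n=\mathbb{C}^n\times\mathbb{R}$ be the Heisenberg group with product $(z,t)(z',t')=(z+z',\,t+t'+\operatorname{Im}(z\cdot\overline{z'}))$. Let $K\subset U(n)$ be a compact connected subgroup such that $(K,\mathbb{H}^n)$ is a Gelfand pair, i.e. the convolution algebra of those functions in $L^1(\mathbb{H}^n)$ that are invariant under $k\cdot(z,t)=(kz,t)$, $k\in K$, is commutative. Assume that the action of $K$ on $\mathbb{C}^n$ is polar: there is a real linear subspace $T\subset\mathbb{C}^n$ that meets every $K$-orbit and satisfies $\operatorname{Re}\langle Xx,y\rangle=0$ for all $x,y\in T$ and all $X$ in the Lie algebra of $K$. Fix such a $T$ and let $M=\{k\in K: kq=q \text{ for all } q\in T\}$. Suppose that $\dim V_\delta^M=1$ for every irreducible unitary representation $\delta$ of $K$, on a space $V_\delta$, whose space $V_\delta^M$ of $M$-fixed vectors is nonzero. Then there exist $J\in U(n)$ and positive integers $n_1,\dots,n_m$ with $n_1+\cdots+n_m=n$ such that $$\mathcal{P}(\mathbb{C}^n_{\mathbb{R}})^{K}=\mathcal{P}(\mathbb{C}^n_{\mathbb{R}})^{K_0},\qquad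 K_0=J\,[U(n_1)\times\cdots\times U(n_m)]\,J^{-1},$$ where $U(n_1)\times\cdots\times U(n_m)\subset U(n)$ is the group of block diagonal unitary matrices with blocks of these sizes, and, for a subgroup $G\subset U(n)$, $\mathcal{P}(\mathbb{C}^n_{\mathbb{R}})^{G}$ denotes the algebra of polynomials in $z$ and $\bar z$ with complex coefficients that are invariant under $G$. -/

import Mathlib

open MeasureTheory

noncomputable section

namespace PolarGelfand

/-- The unitary group `U(n)`, with the topology induced from the `n × n` complex matrices. -/
abbrev UGroup (n : ℕ) := Matrix.unitaryGroup (Fin n) ℂ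

/-- The action of `U(n)` on `ℂⁿ`. -/
def act {n : ℕ} (k : UGroup n) (z : Fin n → ℂ) : Fin n → ℂ :=
  Matrix.mulVec (k : Matrix (Fin n) (Fin n) ℂ) z

/-- The Hermitian form `z · w̄ = ∑ zⱼ w̄ⱼ` on `ℂⁿ`; its real part is the Euclidean inner
product of the underlying real space. -/
def herm {n : ℕ} (z w : Fin n → ℂ) : ℂ := z ⬝ᵥ star w

/-! ### Polar actions -/

/-- The Lie algebra of a closed subgroup `K` of `U(n)`: the matrices `X` with
`exp (t X) ∈ K` for all real `t`. -/
def lieAlg {n : ℕ} (K : Subgroup (UGroup n)) : Set (Matrix (Fin n) (Fin n) ℂ) :=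
  {X | ∀ t : ℝ, ∃ k ∈ K, (k : Matrix (Fin n) (Fin n) ℂ) = NormedSpace.exp (t • X)}

/-- `T` is a `K`-transversal domain: a real linear subspace of `ℂⁿ` that meets every `K`-orbit
and is orthogonal to the orbit at each of its points. The action of `K` is polar if and only if
such a `T` exists. -/
structure IsTransversalDomain {n : ℕ} (K : Subgroup (UGroup n))
    (T : Submodule ℝ (Fin n → ℂ)) : Prop where
  meets : ∀ z : Fin n → ℂ, ∃ k ∈ K, act k z ∈ T
  orthogonal : ∀ x ∈ T, ∀ y ∈ T, ∀ X ∈ lieAlg K, (herm (Matrix.mulVec X x) y).re = 0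

/-- The pointwise stabilizer `M = K_T` of `T` in `K`. -/
def stabilizer {n : ℕ} (K : Subgroup (UGroup n)) (T : Submodule ℝ (Fin n → ℂ)) :
    Subgroup K where
  carrier := {k | ∀ q ∈ T, act (k : UGroup n) q = q}
  one_mem' := by
    intro q _
    simp [act]
  mul_mem' := by
    intro a b ha hb q hq
    have h : act ((a * b : K) : UGroup n) q = act (a : UGroup n) (act (b : UGroup n) q) := by
      simp [act, Matrix.mulVec_mulVec]
    rw [h, hb q hq, ha q hq]
  inv_mem' := by
    intro a ha q hq
    have h : act ((a⁻¹ * a : K) : UGroup n) q =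
        act ((a⁻¹ : K) : UGroup n) (act (a : UGroup n) q) := by
      simp only [act, Matrix.mulVec_mulVec]
      rfl
    rw [ha q hq, inv_mul_cancel] at h
    rw [← h]
    simp [act]

/-! ### Class one representations -/

/-- Every irreducible unitary representation `δ` of `K` with a nonzero `M`-fixed vector satisfies
`dim V_δ^M = 1`. (Irreducible unitary representations of a compact group are finite
dimensional.) -/
def ClassOneDimOne {n : ℕ} (K : Subgroup (UGroup n)) (M : Subgroup K) : Prop :=
  ∀ (V : Type) [NormedAddCommGroup V] [InnerProductSpace ℂ V] [FiniteDimensional ℂ V]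
    (δ : Representation ℂ K V),
    (∀ k v w, inner ℂ (δ k v) (δ k w) = inner ℂ v w) →
    (∀ v, Continuous fun k => δ k v) →
    δ.IsIrreducible →
    Representation.invariants (δ.comp M.subtype) ≠ ⊥ →
    Module.finrank ℂ (Representation.invariants (δ.comp M.subtype)) = 1

/-! ### The Heisenberg group and Gelfand pairs -/

/-- The underlying manifold `ℂⁿ × ℝ` of the Heisenberg group; its Haar measure is Lebesgue
measure `volume`. -/
abbrev Heis (n : ℕ) := (Fin n → ℂ) × ℝ

/-- The group law `(z,t)(z',t') = (z + z', t + t' + Im (z · z̄'))`. -/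
def heisMul {n : ℕ} (a b : Heis n) : Heis n :=
  (a.1 + b.1, a.2 + b.2 + (herm a.1 b.1).im)

/-- The inverse `(z,t)⁻¹ = (-z,-t)`. -/
def heisInv {n : ℕ} (a : Heis n) : Heis n := (-a.1, -a.2)

/-- The action `k · (z,t) = (k · z, t)` by automorphisms. -/
def heisAct {n : ℕ} (k : UGroup n) (a : Heis n) : Heis n := (act k a.1, a.2)

/-- Convolution on the Heisenberg group. -/
def heisConv {n : ℕ} (f g : Heis n → ℂ) (a : Heis n) : ℂ :=
  ∫ b, f (heisMul a (heisInv b)) * g b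

/-- `f` represents an element of `L¹_K(ℍⁿ)`. -/
def IsInvariantL1 {n : ℕ} (K : Subgroup (UGroup n)) (f : Heis n → ℂ) : Prop :=
  Integrable f ∧ ∀ k ∈ K, (fun a => f (heisAct k a)) =ᵐ[volume] f

/-- `(K, ℍⁿ)` is a Gelfand pair: the convolution algebra `L¹_K(ℍⁿ)` is commutative. -/
def IsGelfandPair {n : ℕ} (K : Subgroup (UGroup n)) : Prop :=
  ∀ f g : Heis n → ℂ, IsInvariantL1 K f → IsInvariantL1 K g →
    heisConv f g =ᵐ[volume] heisConv g f

/-! ### Invariant polynomials -/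

/-- The value at `z` of a polynomial in the variables `z` (left) and `z̄` (right). -/
def evalAt {n : ℕ} (z : Fin n → ℂ) : MvPolynomial (Fin n ⊕ Fin n) ℂ →ₐ[ℂ] ℂ :=
  MvPolynomial.aeval (Sum.elim z (star z))

/-- The algebra of `G`-invariant polynomials in `z` and `z̄` with complex coefficients, i.e.
invariant polynomials on the real vector space underlying `ℂⁿ`. -/
def invariantPolynomials {n : ℕ} (G : Subgroup (UGroup n)) :
    Subalgebra ℂ (MvPolynomial (Fin n ⊕ Fin n) ℂ) where
  carrier := {p | ∀ k ∈ G, ∀ z, evalAt (act k z) p = evalAt z p}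
  mul_mem' := by
    intro p q hp hq k hk z
    rw [map_mul, map_mul, hp k hk z, hq k hk z]
  add_mem' := by
    intro p q hp hq k hk z
    rw [map_add, map_add, hp k hk z, hq k hk z]
  algebraMap_mem' := by
    intro c k _ z
    rw [AlgHom.commutes, AlgHom.commutes]

/-! ### Block diagonal unitary groups -/

/-- The block diagonal embedding of `U(n₁) × ⋯ × U(n_m)` into `U(n)`, `n = n₁ + ⋯ + n_m`, the
blocks being intervals of consecutive indices. -/
def blockHom {n m : ℕ} (ν : Fin m → ℕ) (h : ∑ j, ν j = n) :
    (∀ j, UGroup (ν j)) →* UGroup n where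
  toFun U := ⟨Matrix.reindex (finSigmaFinEquiv.trans (finCongr h))
      (finSigmaFinEquiv.trans (finCongr h))
      (Matrix.blockDiagonal' fun j => (U j : Matrix (Fin (ν j)) (Fin (ν j)) ℂ)), by
    have hU : ∀ j, (U j : Matrix (Fin (ν j)) (Fin (ν j)) ℂ) *
        (U j : Matrix (Fin (ν j)) (Fin (ν j)) ℂ).conjTranspose = 1 :=
      fun j => Matrix.mem_unitaryGroup_iff.1 (U j).2
    rw [Matrix.mem_unitaryGroup_iff, Matrix.star_eq_conjTranspose, Matrix.conjTranspose_reindex,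
      Matrix.blockDiagonal'_conjTranspose, Matrix.reindex_apply, Matrix.reindex_apply,
      Matrix.submatrix_mul_equiv, ← Matrix.blockDiagonal'_mul]
    simp only [hU]
    have h1 : Matrix.blockDiagonal' (fun j => (1 : Matrix (Fin (ν j)) (Fin (ν j)) ℂ)) = 1 :=
      Matrix.blockDiagonal'_one
    rw [h1, Matrix.submatrix_one_equiv]⟩
  map_one' := by
    apply Subtype.ext
    have h1 : Matrix.blockDiagonal' (fun j => (1 : Matrix (Fin (ν j)) (Fin (ν j)) ℂ)) = 1 :=
      Matrix.blockDiagonal'_one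
    change Matrix.reindex _ _ (Matrix.blockDiagonal' fun j =>
      (1 : Matrix (Fin (ν j)) (Fin (ν j)) ℂ)) = 1
    rw [h1, Matrix.reindex_apply, Matrix.submatrix_one_equiv]
  map_mul' := by
    intro U W
    apply Subtype.ext
    change Matrix.reindex _ _ (Matrix.blockDiagonal' fun j =>
      (U j : Matrix (Fin (ν j)) (Fin (ν j)) ℂ) * (W j : Matrix (Fin (ν j)) (Fin (ν j)) ℂ)) =
      Matrix.reindex _ _ (Matrix.blockDiagonal' fun j => (U j : Matrix (Fin (ν j)) (Fin (ν j)) ℂ)) *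
      Matrix.reindex _ _ (Matrix.blockDiagonal' fun j => (W j : Matrix (Fin (ν j)) (Fin (ν j)) ℂ))
    rw [Matrix.blockDiagonal'_mul, Matrix.reindex_apply, Matrix.reindex_apply,
      Matrix.reindex_apply, Matrix.submatrix_mul_equiv]

/-- `U(n₁) × ⋯ × U(n_m)` as a subgroup of `U(n)`. -/
def blockUnitary {n m : ℕ} (ν : Fin m → ℕ) (h : ∑ j, ν j = n) : Subgroup (UGroup n) :=
  (blockHom ν h).range

/-- The conjugate subgroup `J G J⁻¹`. -/
def conjSubgroup {n : ℕ} (J : UGroup n) (G : Subgroup (UGroup n)) : Subgroup (UGroup n) :=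
  G.map (MulAut.conj J).toMonoidHom

end PolarGelfand

end

/-!
Commutativity, tested on `F(z) t` against `G(w) κ(s)`, says that `∫ F(z - w) Im⟨z, w⟩ G(w) dw = 0`
for `K`-invariant `F` and `G`. Take `G` to be the derivative of a bump function composed with the
quadratic form of `1 + S`, where `S ≥ 0` commutes with `K`. Integrating by parts and rescaling, one
finds that an invariant polynomial `F` is annihilated by the vector field `z ↦ i P z` for every
orthogonal projection `P` commuting with `K`. Hence `F` does not change when the `K`-irreducible
constituents of `ℂⁿ` are multiplied by independent phases.

Every `K`-orbit meets `T`, hence meets the `M`-fixed vectors, and since `dim V^M = 1` these form a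
complex line in each constituent `V`. So two vectors whose components have the same norms, that is,
two vectors in the same orbit of the product of the unitary groups of the constituents, agree up to
`K` and independent phases, and `F` takes the same value at both.
-/

noncomputable section

namespace PolarGelfand

open Filter Topology
open scoped ComplexOrder

variable {n : ℕ}

/-! ### The Hermitian form -/

lemma herm_neg_left (z w : Fin n → ℂ) : herm (-z) w = -herm z w := by
  simp [herm]

lemma herm_neg_right (z w : Fin n → ℂ) : herm z (-w) = -herm z w := by
  simp [herm]

lemma herm_add_left (z z' w : Fin n → ℂ) : herm (z + z') w = herm z w + herm z' w := by
  simp [herm, add_dotProduct]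

lemma herm_add_right (z w w' : Fin n → ℂ) : herm z (w + w') = herm z w + herm z w' := by
  simp [herm, dotProduct_add]

lemma herm_smul_left (c : ℂ) (z w : Fin n → ℂ) : herm (c • z) w = c * herm z w := by
  simp [herm]

lemma herm_smul_right (c : ℂ) (z w : Fin n → ℂ) : herm z (c • w) = star c * herm z w := by
  simp [herm]

lemma star_herm (z w : Fin n → ℂ) : star (herm z w) = herm w z := by
  simp [herm, dotProduct, mul_comm]

lemma herm_im_swap (z w : Fin n → ℂ) : (herm z w).im = -(herm w z).im := by
  simp [← star_herm w z]

lemma herm_self_im (z : Fin n → ℂ) : (herm z z).im = 0 := by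
  linarith [herm_im_swap z z]

lemma herm_mulVec_left (A : Matrix (Fin n) (Fin n) ℂ) (z w : Fin n → ℂ) :
    herm (A.mulVec z) w = herm z (A.conjTranspose.mulVec w) := by
  simp only [herm, Matrix.star_mulVec, Matrix.conjTranspose_conjTranspose]
  rw [dotProduct_comm, Matrix.dotProduct_mulVec, dotProduct_comm]

lemma herm_act (k : UGroup n) (z w : Fin n → ℂ) : herm (act k z) (act k w) = herm z w := by
  have hk : (k : Matrix (Fin n) (Fin n) ℂ).conjTranspose * k = 1 :=
    Matrix.mem_unitaryGroup_iff'.1 k.2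
  rw [act, herm_mulVec_left, act, Matrix.mulVec_mulVec, hk, Matrix.one_mulVec]

lemma inner_toLp_eq_herm (z w : Fin n → ℂ) :
    inner ℂ (WithLp.toLp 2 z) (WithLp.toLp 2 w) = herm w z :=
  EuclideanSpace.inner_eq_star_dotProduct _ _

lemma norm_toLp_act (k : UGroup n) (z : Fin n → ℂ) :
    ‖WithLp.toLp 2 (act k z)‖ = ‖WithLp.toLp 2 z‖ := by
  simp only [@norm_eq_sqrt_re_inner ℂ, inner_toLp_eq_herm, herm_act]

lemma norm_le_norm_toLp (z : Fin n → ℂ) : ‖z‖ ≤ ‖WithLp.toLp 2 z‖ :=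
  (pi_norm_le_iff_of_nonneg (norm_nonneg _)).2 fun i => PiLp.norm_apply_le (WithLp.toLp 2 z) i

@[fun_prop]
lemma continuous_herm {X : Type*} [TopologicalSpace X] {f g : X → Fin n → ℂ}
    (hf : Continuous f) (hg : Continuous g) : Continuous fun x => herm (f x) (g x) := by
  unfold herm
  fun_prop

/-! ### Cutoff functions and compactly supported integrands -/

lemma hasCompactSupport_comp_of_tendsto {E F : Type*} [TopologicalSpace E] [R1Space E] [Zero F]
    {N : E → ℝ} (hN : Tendsto N (cocompact E) atTop) {γ : ℝ → F} (hγ : HasCompactSupport γ) :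
    HasCompactSupport fun x => γ (N x) := by
  rw [hasCompactSupport_iff_eventuallyEq, coclosedCompact_eq_cocompact] at hγ ⊢
  exact (hN.mono_right atTop_le_cocompact).eventually hγ

lemma continuous_integral_mul_of_hasCompactSupport {X Y : Type*} [TopologicalSpace X]
    [TopologicalSpace Y] [MeasurableSpace Y] [OpensMeasurableSpace Y] {μ : Measure Y}
    [IsFiniteMeasureOnCompacts μ] {f : X → Y → ℂ} (hf : Continuous f.uncurry) {g : Y → ℂ}
    (hg : Continuous g) (hgs : HasCompactSupport g) :
    Continuous fun x => ∫ y, f x y * g y ∂μ := by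
  rw [← continuousOn_univ]
  refine continuousOn_integral_of_compact_support hgs ?_ fun x y _ hy => ?_
  · exact (hf.mul (hg.comp continuous_snd)).continuousOn
  · rw [image_eq_zero_of_notMem_tsupport hy, mul_zero]

lemma hasCompactSupport_mul_prod {X Y R : Type*} [TopologicalSpace X] [TopologicalSpace Y]
    [R1Space X] [R1Space Y] [MulZeroClass R] {f : X → R} {g : Y → R} (hf : HasCompactSupport f)
    (hg : HasCompactSupport g) : HasCompactSupport fun p : X × Y => f p.1 * g p.2 := by
  refine HasCompactSupport.intro (hf.isCompact.prod hg.isCompact) fun p hp => ?_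
  obtain hp | hp := not_and_or.1 hp
  · rw [image_eq_zero_of_notMem_tsupport hp, zero_mul]
  · rw [image_eq_zero_of_notMem_tsupport hp, mul_zero]

/-! ### Commutativity of convolution -/

@[fun_prop]
lemma continuous_heisMul : Continuous fun p : Heis n × Heis n => heisMul p.1 p.2 := by
  unfold heisMul
  fun_prop

@[fun_prop]
lemma continuous_heisInv : Continuous (heisInv (n := n)) := by
  unfold heisInv
  fun_prop

/-- The homeomorphism `b ↦ b⁻¹ a` of the Heisenberg group, whose inverse is `b ↦ a b⁻¹`. -/
def invMulHomeomorph (a : Heis n) : Heis n ≃ₜ Heis n where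
  toFun b := heisMul (heisInv b) a
  invFun b := heisMul a (heisInv b)
  left_inv b := by
    ext
    · simp [heisMul, heisInv]
    · simp [heisMul, heisInv, herm_neg_left, herm_neg_right, herm_add_right, herm_self_im,
        herm_im_swap b.1 a.1]
      ring
  right_inv b := by
    ext
    · simp [heisMul, heisInv]
    · simp [heisMul, heisInv, herm_neg_left, herm_neg_right, herm_add_left, herm_self_im,
        herm_im_swap b.1 a.1]
      ring
  continuous_toFun := continuous_heisMul.comp (continuous_heisInv.prodMk continuous_const)
  continuous_invFun := continuous_heisMul.comp (continuous_const.prodMk continuous_heisInv)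

lemma invMulHomeomorph_apply (a b : Heis n) :
    invMulHomeomorph a b = (a.1 - b.1, a.2 - (herm b.1 a.1).im - b.2) := by
  ext1
  · exact (neg_add_eq_sub b.1 a.1)
  · change -b.2 + a.2 + (herm (-b.1) a.1).im = a.2 - (herm b.1 a.1).im - b.2
    rw [herm_neg_left, Complex.neg_im]
    ring

lemma measurePreserving_invMulHomeomorph (a : Heis n) :
    MeasurePreserving (invMulHomeomorph a) volume volume := by
  rw [funext (invMulHomeomorph_apply a)]
  refine (Measure.measurePreserving_sub_left volume a.1).skew_product
    (g := fun w s => a.2 - (herm w a.1).im - s) ?_ (Eventually.of_forall fun w => ?_)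
  · exact Continuous.measurable (by unfold Function.uncurry; fun_prop)
  · exact (Measure.measurePreserving_sub_left volume (a.2 - (herm w a.1).im)).map_eq

lemma heisConv_eq_integral_inv_mul (f g : Heis n → ℂ) (a : Heis n) :
    heisConv g f a = ∫ b, f (heisMul (heisInv b) a) * g b := by
  have hcancel : ∀ b, heisMul a (heisInv (invMulHomeomorph a b)) = b :=
    (invMulHomeomorph a).left_inv
  calc heisConv g f a
      = ∫ b, g (heisMul a (heisInv (invMulHomeomorph a b))) * f (invMulHomeomorph a b) :=
        ((measurePreserving_invMulHomeomorph a).integral_comp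
          (invMulHomeomorph a).measurableEmbedding _).symm
    _ = ∫ b, f (heisMul (heisInv b) a) * g b := by
        simp only [hcancel, mul_comm (g _)]
        rfl

lemma heisConv_comm_of_hasCompactSupport {K : Subgroup (UGroup n)} (hK : IsGelfandPair K)
    {f g : Heis n → ℂ}
    (hf : Continuous f) (hfs : HasCompactSupport f) (hfK : ∀ k ∈ K, ∀ a, f (heisAct k a) = f a)
    (hg : Continuous g) (hgs : HasCompactSupport g) (hgK : ∀ k ∈ K, ∀ a, g (heisAct k a) = g a) :
    heisConv f g = heisConv g f := by
  have hL1 : ∀ φ : Heis n → ℂ, Continuous φ → HasCompactSupport φ →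
      (∀ k ∈ K, ∀ a, φ (heisAct k a) = φ a) → IsInvariantL1 K φ := fun φ hφ hφs hφK =>
    ⟨hφ.integrable_of_hasCompactSupport hφs, fun k hk => Eventually.of_forall (hφK k hk)⟩
  refine (Continuous.ae_eq_iff_eq (volume : Measure (Heis n)) ?_ ?_).1
    (hK f g (hL1 f hf hfs hfK) (hL1 g hg hgs hgK))
  · exact continuous_integral_mul_of_hasCompactSupport
      (f := fun a b => f (heisMul a (heisInv b))) (by unfold Function.uncurry; fun_prop) hg hgs
  · rw [funext (heisConv_eq_integral_inv_mul f g)]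
    exact continuous_integral_mul_of_hasCompactSupport
      (f := fun a b => f (heisMul (heisInv b) a)) (by unfold Function.uncurry; fun_prop) hg hgs

/-- A smooth bump function on `ℝ`, equal to `1` on `[-R, R]`; composed with proper `K`-invariant
functions it gives the invariant cutoffs used to pass to compact supports. -/
def cutoff (R : ℝ) (hR : 0 < R) : ContDiffBump (0 : ℝ) := ⟨R, R + 1, hR, by linarith⟩

/-- A proper `U(n)`-invariant gauge on the Heisenberg group. -/
def heisGauge (a : Heis n) : ℝ := ‖WithLp.toLp 2 a.1‖ + |a.2|

lemma heisGauge_heisAct (k : UGroup n) (a : Heis n) : heisGauge (heisAct k a) = heisGauge a := by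
  simp only [heisGauge, heisAct, norm_toLp_act]

lemma continuous_heisGauge : Continuous (heisGauge (n := n)) := by
  unfold heisGauge
  fun_prop

lemma tendsto_heisGauge_atTop : Tendsto (heisGauge (n := n)) (cocompact _) atTop := by
  refine tendsto_atTop_mono (fun a => ?_) (tendsto_norm_cocompact_atTop (E := Heis n))
  rw [Prod.norm_def, Real.norm_eq_abs]
  exact max_le ((norm_le_norm_toLp a.1).trans (le_add_of_nonneg_right (abs_nonneg _)))
    (le_add_of_nonneg_left (norm_nonneg _))

lemma exists_invariant_cutoff {C : Set (Heis n)} (hC : IsCompact C) :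
    ∃ χ : Heis n → ℝ, Continuous χ ∧ HasCompactSupport χ ∧ (∀ k a, χ (heisAct k a) = χ a) ∧
      ∀ a ∈ C, χ a = 1 := by
  obtain ⟨R, hR⟩ := (hC.image continuous_heisGauge).bddAbove
  have hR1 : 0 < max R 1 := lt_max_of_lt_right one_pos
  refine ⟨fun a => cutoff (max R 1) hR1 (heisGauge a),
    (cutoff _ hR1).continuous.comp continuous_heisGauge,
    hasCompactSupport_comp_of_tendsto tendsto_heisGauge_atTop (cutoff _ hR1).hasCompactSupport,
    fun k a => by simp only [heisGauge_heisAct],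
    fun a ha => (cutoff _ hR1).one_of_mem_closedBall ?_⟩
  have hnonneg : 0 ≤ heisGauge a := by unfold heisGauge; positivity
  rw [mem_closedBall_zero_iff, Real.norm_of_nonneg hnonneg]
  exact (hR (Set.mem_image_of_mem _ ha)).trans (le_max_left _ _)

/-- Only the values of `f` on a compact set enter, so `f` may be cut off. -/
lemma heisConv_comm_of_continuous {K : Subgroup (UGroup n)} (hK : IsGelfandPair K)
    {f g : Heis n → ℂ} (hf : Continuous f) (hfK : ∀ k ∈ K, ∀ a, f (heisAct k a) = f a)
    (hg : Continuous g) (hgs : HasCompactSupport g) (hgK : ∀ k ∈ K, ∀ a, g (heisAct k a) = g a)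
    (a : Heis n) :
    heisConv f g a = heisConv g f a := by
  have hright : Continuous fun b => heisMul a (heisInv b) := by fun_prop
  have hleft : Continuous fun b => heisMul (heisInv b) a := by fun_prop
  obtain ⟨χ, hχ, hχs, hχK, hχ1⟩ :=
    exists_invariant_cutoff ((hgs.isCompact.image hright).union (hgs.isCompact.image hleft))
  have hcut : ∀ φ : Heis n → Heis n, (∀ b ∈ tsupport g, χ (φ b) = 1) →
      ∫ b, f (φ b) * g b = ∫ b, χ (φ b) * f (φ b) * g b := by
    refine fun φ hφ => integral_congr_ae (Eventually.of_forall fun b => ?_)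
    by_cases hb : b ∈ tsupport g
    · simp [hφ b hb]
    · simp [image_eq_zero_of_notMem_tsupport hb]
  have hcomm := heisConv_comm_of_hasCompactSupport hK (f := fun a => χ a * f a) (by fun_prop)
    (hχs.comp_left Complex.ofReal_zero).mul_right (fun k hk a => by rw [hχK, hfK k hk]) hg hgs hgK
  rw [heisConv_eq_integral_inv_mul f g, heisConv, hcut _ fun b hb => hχ1 _ (.inl ⟨b, hb, rfl⟩),
    hcut _ fun b hb => hχ1 _ (.inr ⟨b, hb, rfl⟩)]
  exact (congrFun hcomm a).trans (heisConv_eq_integral_inv_mul _ g a)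

/-- Test commutativity on `(z, t) ↦ F z * t` and `(w, s) ↦ G w * κ s` at the point `(z, 0)`: the
central coordinates of `a b⁻¹` and `b⁻¹ a` differ by `2 Im (z · w̄)`. -/
lemma integral_mul_im_herm_mul_eq_zero {K : Subgroup (UGroup n)} (hK : IsGelfandPair K)
    {F G : (Fin n → ℂ) → ℂ} (hF : Continuous F) (hFK : ∀ k ∈ K, ∀ z, F (act k z) = F z)
    (hG : Continuous G) (hGs : HasCompactSupport G) (hGK : ∀ k ∈ K, ∀ z, G (act k z) = G z)
    (z : Fin n → ℂ) : ∫ w, F (z - w) * ((herm z w).im * G w) = 0 := by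
  set κ := cutoff 1 one_pos
  have hκ : ∫ s, (κ s : ℂ) ≠ 0 := by
    rw [integral_complex_ofReal]
    exact_mod_cast κ.integral_pos.ne'
  have hκs : HasCompactSupport fun s => (κ s : ℂ) :=
    κ.hasCompactSupport.comp_left Complex.ofReal_zero
  have hg : Continuous fun b : Heis n => G b.1 * (κ b.2 : ℂ) := by
    have := κ.continuous
    fun_prop
  have hgs := hasCompactSupport_mul_prod hGs hκs
  have hcomm := heisConv_comm_of_continuous hK (f := fun a => F a.1 * (a.2 : ℂ)) (by fun_prop)
    (fun k hk a => by simp only [heisAct, hFK k hk]) hg hgs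
    (fun k hk a => by simp only [heisAct, hGK k hk]) (z, 0)
  rw [heisConv_eq_integral_inv_mul (fun a : Heis n => F a.1 * (a.2 : ℂ)), heisConv] at hcomm
  have hint : ∀ φ : Heis n → Heis n, Continuous φ →
      Integrable fun b => F (φ b).1 * ((φ b).2 : ℂ) * (G b.1 * (κ b.2 : ℂ)) := fun φ hφ =>
    Continuous.integrable_of_hasCompactSupport (by fun_prop) hgs.mul_left
  have hprod : ∫ b : Heis n, -2 * (F (z - b.1) * ((herm z b.1).im * G b.1)) * (κ b.2 : ℂ) = 0 := by
    rw [← sub_eq_zero.2 hcomm, ← integral_sub (hint _ (by fun_prop)) (hint _ (by fun_prop))]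
    congr 1 with b
    simp only [heisMul, heisInv, herm_neg_left, herm_neg_right, Complex.neg_im,
      herm_im_swap b.1 z, neg_add_eq_sub, ← sub_eq_add_neg]
    push_cast
    ring
  rw [Measure.volume_eq_prod, integral_prod_mul
    (fun w => -2 * (F (z - w) * ((herm z w).im * G w))) fun s => (κ s : ℂ), integral_const_mul,
    mul_eq_zero, or_iff_left hκ] at hprod
  simpa using hprod

/-! ### Infinitesimal invariance -/

/-- The Hermitian quadratic form `w ↦ ⟨A w, w⟩` of a matrix `A` (real valued for Hermitian `A`);
its level sets play the role of spheres. -/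
def quadForm (A : Matrix (Fin n) (Fin n) ℂ) (w : Fin n → ℂ) : ℝ := (herm (A.mulVec w) w).re

lemma continuous_quadForm (A : Matrix (Fin n) (Fin n) ℂ) : Continuous (quadForm A) := by
  unfold quadForm
  fun_prop

lemma quadForm_act {A : Matrix (Fin n) (Fin n) ℂ} {k : UGroup n}
    (hk : Commute A (k : Matrix (Fin n) (Fin n) ℂ)) (w : Fin n → ℂ) :
    quadForm A (act k w) = quadForm A w := by
  have hcomm : A.mulVec (act k w) = act k (A.mulVec w) := by
    simp only [act, Matrix.mulVec_mulVec, hk.eq]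
  rw [quadForm, hcomm, herm_act, quadForm]

lemma sq_norm_le_quadForm_one_add {S : Matrix (Fin n) (Fin n) ℂ} (hS : S.PosSemidef)
    (w : Fin n → ℂ) : ‖w‖ ^ 2 ≤ quadForm (1 + S) w := by
  have hself : (herm w w).re = ‖WithLp.toLp 2 w‖ ^ 2 := by
    rw [← inner_toLp_eq_herm, ← inner_self_eq_norm_sq (𝕜 := ℂ)]
    rfl
  have hS0 : 0 ≤ (herm (S.mulVec w) w).re := by
    rw [herm, dotProduct_comm]
    exact hS.re_dotProduct_nonneg w
  rw [quadForm, Matrix.add_mulVec, Matrix.one_mulVec, herm_add_left, Complex.add_re, hself]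
  have := norm_le_norm_toLp w
  nlinarith [norm_nonneg w]

lemma tendsto_quadForm_one_add_atTop {S : Matrix (Fin n) (Fin n) ℂ} (hS : S.PosSemidef) :
    Tendsto (quadForm (1 + S)) (cocompact _) atTop :=
  tendsto_atTop_mono (sq_norm_le_quadForm_one_add hS)
    ((tendsto_pow_atTop two_ne_zero).comp (tendsto_norm_cocompact_atTop (E := Fin n → ℂ)))

lemma hasLineDerivAt_quadForm {A : Matrix (Fin n) (Fin n) ℂ} (hA : A.IsHermitian)
    (w x : Fin n → ℂ) :
    HasLineDerivAt ℝ (quadForm A) (-2 * (herm (A.mulVec x) w).im) w (Complex.I • x) := by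
  have hswap : herm (A.mulVec w) x = star (herm (A.mulVec x) w) := by
    rw [star_herm, herm_mulVec_left, hA.eq]
  have hexpand : ∀ t : ℝ, quadForm A (w + t • Complex.I • x) =
      quadForm A w + t * (-2 * (herm (A.mulVec x) w).im) + t ^ 2 * quadForm A x := by
    intro t
    simp only [quadForm, ← Complex.coe_smul t, Matrix.mulVec_add, Matrix.mulVec_smul,
      herm_add_left, herm_add_right, herm_smul_left, herm_smul_right, hswap, RCLike.star_def,
      Complex.conj_ofReal, Complex.conj_I, Complex.add_re, Complex.mul_re, Complex.mul_im,
      Complex.neg_re, Complex.neg_im, Complex.ofReal_re, Complex.ofReal_im, Complex.I_re,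
      Complex.I_im, Complex.conj_re, Complex.conj_im, Complex.add_im]
    ring
  have hpoly : HasDerivAt (fun t : ℝ => quadForm A w + t * (-2 * (herm (A.mulVec x) w).im) +
      t ^ 2 * quadForm A x) (-2 * (herm (A.mulVec x) w).im) 0 := by
    have h := (((hasDerivAt_id (0 : ℝ)).mul_const (-2 * (herm (A.mulVec x) w).im)).const_add
      (quadForm A w)).fun_add ((hasDerivAt_pow 2 (0 : ℝ)).mul_const (quadForm A x))
    simpa using h
  rw [HasLineDerivAt, funext hexpand]
  exact hpoly

lemma hasLineDerivAt_comp_sub {E F : Type*} [NormedAddCommGroup E] [NormedSpace ℝ E]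
    [NormedAddCommGroup F] [NormedSpace ℝ F] {f : E → F} (hf : Differentiable ℝ f) (z w v : E) :
    HasLineDerivAt ℝ (fun w => f (z - w)) (-fderiv ℝ f (z - w) v) w v := by
  have h := (hf (z - w)).hasFDerivAt.comp w ((hasFDerivAt_id w).const_sub z)
  simpa [Function.comp_def] using h.hasLineDerivAt v

lemma hasLineDerivAt_comp_quadForm {A : Matrix (Fin n) (Fin n) ℂ} (hA : A.IsHermitian)
    {γ : ℝ → ℝ} (hγ : Differentiable ℝ γ) (w x : Fin n → ℂ) :
    HasLineDerivAt ℝ (fun w => (γ (quadForm A w) : ℂ))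
      (-2 * ((herm (A.mulVec x) w).im * ((deriv γ (quadForm A w) : ℝ) : ℂ))) w (Complex.I • x) := by
  have hγQ := (hγ (quadForm A w)).hasDerivAt.comp_of_eq (0 : ℝ) (hasLineDerivAt_quadForm hA w x)
    (by simp)
  refine (hγQ.ofReal_comp).congr_deriv ?_
  push_cast
  ring

lemma integral_fderiv_comp_sub_mul {E : Type*} [NormedAddCommGroup E] [NormedSpace ℝ E]
    [FiniteDimensional ℝ E] [MeasurableSpace E] [BorelSpace E] {μ : Measure E} [μ.IsAddHaarMeasure]
    {F g g' : E → ℂ} {v : E} (hF : ContDiff ℝ 1 F) (hg : Continuous g) (hgs : HasCompactSupport g)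
    (hg' : Continuous g') (hgs' : HasCompactSupport g')
    (hgg' : ∀ w, HasLineDerivAt ℝ g (g' w) w v) (z : E) :
    ∫ w, fderiv ℝ F (z - w) v * g w ∂μ = ∫ w, F (z - w) * g' w ∂μ := by
  have hFc := hF.continuous
  have := hF.continuous_fderiv one_ne_zero
  have hparts := integral_bilinear_hasLineDerivAt_right_eq_neg_left_of_integrable (μ := μ)
    (B := ContinuousLinearMap.mul ℝ ℂ) (f := fun w => F (z - w)) (g := g) (g' := g') (v := v)
    (Continuous.integrable_of_hasCompactSupport (by
      simp only [ContinuousLinearMap.mul_apply']; fun_prop) hgs.mul_left)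
    (Continuous.integrable_of_hasCompactSupport (by
      simp only [ContinuousLinearMap.mul_apply']; fun_prop) hgs'.mul_left)
    (Continuous.integrable_of_hasCompactSupport (by
      simp only [ContinuousLinearMap.mul_apply']; fun_prop) hgs.mul_left)
    (fun w _ => hasLineDerivAt_comp_sub (hF.differentiable one_ne_zero) z w v)
    (fun w _ => hgg' w)
  simpa only [ContinuousLinearMap.mul_apply', neg_mul, integral_neg, neg_neg] using hparts.symm

/-- The `I • x`-derivative of a function of `quadForm A` is a multiple of `Im ⟨A x, w⟩`, so this is
the commutativity identity at `z = A x` after an integration by parts. -/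
lemma integral_fderiv_mul_comp_quadForm_eq_zero {K : Subgroup (UGroup n)} (hK : IsGelfandPair K)
    {S : Matrix (Fin n) (Fin n) ℂ} (hS : S.PosSemidef)
    (hSK : ∀ k ∈ K, Commute S (k : Matrix (Fin n) (Fin n) ℂ)) {γ : ℝ → ℝ} (hγ : ContDiff ℝ 1 γ)
    (hγs : HasCompactSupport γ) {F : (Fin n → ℂ) → ℂ} (hF : ContDiff ℝ 1 F)
    (hFK : ∀ k ∈ K, ∀ z, F (act k z) = F z) (x : Fin n → ℂ) :
    ∫ w, fderiv ℝ F ((1 + S).mulVec x - w) (Complex.I • x) * (γ (quadForm (1 + S) w) : ℂ) = 0 := by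
  have hHerm : (1 + S).IsHermitian := Matrix.isHermitian_one.add hS.isHermitian
  have hAK : ∀ k ∈ K, Commute (1 + S) (k : Matrix (Fin n) (Fin n) ℂ) := fun k hk =>
    (Commute.one_left _).add_left (hSK k hk)
  have hQ := continuous_quadForm (1 + S)
  have hQ_top := tendsto_quadForm_one_add_atTop hS
  generalize 1 + S = A at *
  have hΓ : Continuous fun w => (γ (quadForm A w) : ℂ) := by
    have := hγ.continuous
    fun_prop
  have hΓs : HasCompactSupport fun w => (γ (quadForm A w) : ℂ) :=
    (hasCompactSupport_comp_of_tendsto hQ_top hγs).comp_left Complex.ofReal_zero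
  have hG : Continuous fun w => ((deriv γ (quadForm A w) : ℝ) : ℂ) := by
    have := hγ.continuous_deriv le_rfl
    fun_prop
  have hGs : HasCompactSupport fun w => ((deriv γ (quadForm A w) : ℝ) : ℂ) :=
    (hasCompactSupport_comp_of_tendsto hQ_top hγs.deriv).comp_left Complex.ofReal_zero
  rw [integral_fderiv_comp_sub_mul
    (g' := fun w => -2 * ((herm (A.mulVec x) w).im * ((deriv γ (quadForm A w) : ℝ) : ℂ)))
    hF hΓ hΓs (by fun_prop) hGs.mul_left.mul_left
    fun w => hasLineDerivAt_comp_quadForm hHerm (hγ.differentiable one_ne_zero) w x]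
  simp only [mul_left_comm _ (-2 : ℂ), integral_const_mul]
  rw [integral_mul_im_herm_mul_eq_zero hK hF.continuous hFK hG hGs
    (fun k hk w => by rw [quadForm_act (hAK k hk)]), mul_zero]

lemma integral_comp_quadForm_ne_zero {S : Matrix (Fin n) (Fin n) ℂ} (hS : S.PosSemidef) :
    ∫ w, (cutoff 1 one_pos (quadForm (1 + S) w) : ℂ) ≠ 0 := by
  rw [integral_complex_ofReal]
  refine Complex.ofReal_ne_zero.2 (ne_of_gt ?_)
  refine Continuous.integral_pos_of_hasCompactSupport_nonneg_nonzero (x := 0)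
    ((cutoff _ one_pos).continuous.comp (continuous_quadForm _))
    (hasCompactSupport_comp_of_tendsto (tendsto_quadForm_one_add_atTop hS)
      (cutoff 1 one_pos).hasCompactSupport) (fun _ => (cutoff 1 one_pos).nonneg) ?_
  rw [show quadForm (1 + S) 0 = 0 by simp [quadForm, herm],
    (cutoff 1 one_pos).one_of_mem_closedBall (Metric.mem_closedBall_self zero_le_one)]
  exact one_ne_zero

/-- Dilating `F` shrinks the level sets over which its derivative is averaged to a point. -/
lemma fderiv_one_add_mulVec_eq_zero {K : Subgroup (UGroup n)} (hK : IsGelfandPair K)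
    {S : Matrix (Fin n) (Fin n) ℂ} (hS : S.PosSemidef)
    (hSK : ∀ k ∈ K, Commute S (k : Matrix (Fin n) (Fin n) ℂ)) {F : (Fin n → ℂ) → ℂ}
    (hF : ContDiff ℝ 1 F) (hFK : ∀ k ∈ K, ∀ z, F (act k z) = F z) (x : Fin n → ℂ) :
    fderiv ℝ F ((1 + S).mulVec x) (Complex.I • x) = 0 := by
  set κ := cutoff 1 one_pos
  set average : ℝ → ℂ := fun ε =>
    ∫ w, fderiv ℝ F ((1 + S).mulVec x - ε • w) (Complex.I • x) * (κ (quadForm (1 + S) w) : ℂ)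
  have hcont : Continuous average := by
    have := hF.continuous_fderiv one_ne_zero
    have hκQ : Continuous fun w => (κ (quadForm (1 + S) w) : ℂ) :=
      Complex.continuous_ofReal.comp (κ.continuous.comp (continuous_quadForm _))
    refine continuous_integral_mul_of_hasCompactSupport
      (f := fun ε w => fderiv ℝ F ((1 + S).mulVec x - ε • w) (Complex.I • x)) ?_ hκQ ?_
    · unfold Function.uncurry
      fun_prop
    · exact (hasCompactSupport_comp_of_tendsto (tendsto_quadForm_one_add_atTop hS)
        κ.hasCompactSupport).comp_left Complex.ofReal_zero
  have hne : ∀ ε : ℝ, ε ≠ 0 → average ε = 0 := by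
    intro ε hε
    have hzero := integral_fderiv_mul_comp_quadForm_eq_zero hK hS hSK κ.contDiff
      κ.hasCompactSupport (F := fun z => F (ε • z)) (hF.comp (contDiff_const_smul ε))
      (fun k hk z => by rw [← hFK k hk (ε • z), act, act, Matrix.mulVec_smul]) (ε⁻¹ • x)
    simpa only [fderiv_comp_smul, Matrix.mulVec_smul, smul_sub, smul_inv_smul₀ hε,
      smul_comm Complex.I, smul_apply, map_smul, inv_smul_smul₀ hε] using hzero
  have hall : average = 0 :=
    hcont.ext_on (dense_compl_singleton 0) continuous_const fun ε hε => hne ε hε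
  have h0 := congrFun hall 0
  simp only [average, zero_smul, sub_zero, integral_const_mul, Pi.zero_apply] at h0
  exact (mul_eq_zero.1 h0).resolve_right (integral_comp_quadForm_ne_zero hS)

/-- Compare the values of `1 + S` at `S = 0` and at `S = P`. -/
lemma fderiv_I_smul_mulVec_eq_zero {K : Subgroup (UGroup n)} (hK : IsGelfandPair K)
    {P : Matrix (Fin n) (Fin n) ℂ} (hP : IsStarProjection P)
    (hPK : ∀ k ∈ K, Commute P (k : Matrix (Fin n) (Fin n) ℂ)) {F : (Fin n → ℂ) → ℂ}
    (hF : ContDiff ℝ 1 F) (hFK : ∀ k ∈ K, ∀ z, F (act k z) = F z) (z : Fin n → ℂ) :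
    fderiv ℝ F z (Complex.I • P.mulVec z) = 0 := by
  have hPpos : P.PosSemidef := by
    rw [← hP.isIdempotentElem.eq]
    nth_rw 1 [← hP.isSelfAdjoint.star_eq]
    exact Matrix.posSemidef_conjTranspose_mul_self P
  have hS0 := fderiv_one_add_mulVec_eq_zero hK .zero (fun _ _ => Commute.zero_left _) hF hFK z
  have hSP := fderiv_one_add_mulVec_eq_zero hK hPpos hPK hF hFK (z - (2⁻¹ : ℝ) • P.mulVec z)
  have hinv : (1 + P).mulVec (z - (2⁻¹ : ℝ) • P.mulVec z) = z := by
    have hPP : P.mulVec (P.mulVec z) = P.mulVec z := by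
      rw [Matrix.mulVec_mulVec, hP.isIdempotentElem.eq]
    simp only [Matrix.add_mulVec, Matrix.one_mulVec, Matrix.mulVec_sub, Matrix.mulVec_smul, hPP]
    module
  rw [add_zero, Matrix.one_mulVec] at hS0
  rw [hinv, smul_sub, map_sub, hS0, zero_sub, neg_eq_zero, smul_comm, map_smul] at hSP
  exact (smul_eq_zero.1 hSP).resolve_left (by norm_num)

/-- Differentiate along the curve `s ↦ ∑ j, exp (i s θ j) • P j z`. -/
lemma eq_of_forall_mulVec_eq_exp_smul {ι : Type*} [Fintype ι]
    {P : ι → Matrix (Fin n) (Fin n) ℂ} (hP : CompleteOrthogonalIdempotents P)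
    {F : (Fin n → ℂ) → ℂ} (hF : Differentiable ℝ F)
    (hFP : ∀ j z, fderiv ℝ F z (Complex.I • (P j).mulVec z) = 0) {z z' : Fin n → ℂ} {θ : ι → ℝ}
    (hphase : ∀ j, (P j).mulVec z' = Complex.exp (θ j * Complex.I) • (P j).mulVec z) :
    F z' = F z := by
  have hsum : ∀ x, ∑ j, (P j).mulVec x = x := fun x => by
    rw [← Matrix.sum_mulVec, hP.complete, Matrix.one_mulVec]
  set curve : ℝ → Fin n → ℂ := fun s =>
    ∑ j, Complex.exp ((s * θ j : ℝ) * Complex.I) • (P j).mulVec z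
  have hproj : ∀ j s, (P j).mulVec (curve s) =
      Complex.exp ((s * θ j : ℝ) * Complex.I) • (P j).mulVec z := by
    intro j s
    simp only [curve, Matrix.mulVec_sum, Matrix.mulVec_smul, Matrix.mulVec_mulVec]
    rw [Finset.sum_eq_single j (fun i _ hij => by rw [hP.ortho hij.symm]; simp) (by simp),
      (hP.idem j).eq]
  have hcurve : ∀ s, HasDerivAt curve (∑ j, θ j • Complex.I • (P j).mulVec (curve s)) s := by
    intro s
    refine HasDerivAt.fun_sum fun j _ => ?_
    have hexp := ((((hasDerivAt_id s).mul_const (θ j)).ofReal_comp).mul_const Complex.I).cexp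
    convert! hexp.smul_const ((P j).mulVec z) using 1
    rw [hproj, ← Complex.coe_smul, smul_smul, smul_smul]
    congr 1
    simp only [Complex.ofReal_mul, id_eq, one_mul]
    ring
  have hconst := is_const_of_deriv_eq_zero (f := F ∘ curve)
    (fun s => ((hF _).hasFDerivAt.comp_hasDerivAt s (hcurve s)).differentiableAt)
    (fun s => by
      rw [((hF _).hasFDerivAt.comp_hasDerivAt s (hcurve s)).deriv, map_sum]
      exact Finset.sum_eq_zero fun j _ => by rw [map_smul, hFP, smul_zero]) 1 0
  have h0 : curve 0 = z := by simp [curve, hsum]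
  have h1 : curve 1 = z' := by simp [curve, ← hphase, hsum]
  simpa [h0, h1] using hconst

lemma contDiff_evalAt (p : MvPolynomial (Fin n ⊕ Fin n) ℂ) :
    ContDiff ℝ 1 fun z : Fin n → ℂ => evalAt z p := by
  induction p using MvPolynomial.induction_on with
  | C a => simpa [evalAt] using contDiff_const
  | add p q hp hq => simpa using hp.add hq
  | mul_X p i hp =>
    simp only [map_mul]
    refine hp.mul ?_
    rcases i with i | i
    · simpa [evalAt] using contDiff_apply ℝ ℂ i
    · have hstar : ContDiff ℝ 1 fun z : Fin n → ℂ => star (z i) :=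
        Complex.conjCLE.contDiff.comp (contDiff_apply ℝ ℂ i)
      simpa [evalAt] using hstar

/-! ### Decomposition of unitary representations -/

section Decomposition

variable {𝕜 G E : Type*} [RCLike 𝕜] [Group G] [NormedAddCommGroup E] [InnerProductSpace 𝕜 E]
  {ρ : Representation 𝕜 G E}

/-- The orthogonal complement of a subrepresentation of a unitary representation. -/
def orthogonalSubrep (hρ : ∀ g v w, inner 𝕜 (ρ g v) (ρ g w) = inner 𝕜 v w)
    (σ : Subrepresentation ρ) : Subrepresentation ρ where
  toSubmodule := σ.toSubmoduleᗮ
  apply_mem_toSubmodule g v hv u hu := by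
    rw [← ρ.self_inv_apply g u, hρ]
    exact hv _ (σ.apply_mem_toSubmodule g⁻¹ hu)

lemma starProjection_apply_subrep [FiniteDimensional 𝕜 E]
    (hρ : ∀ g v w, inner 𝕜 (ρ g v) (ρ g w) = inner 𝕜 v w) (σ : Subrepresentation ρ) (g : G)
    (x : E) : σ.toSubmodule.starProjection (ρ g x) = ρ g (σ.toSubmodule.starProjection x) := by
  refine Submodule.eq_starProjection_of_mem_orthogonal
    (σ.apply_mem_toSubmodule g (Submodule.starProjection_apply_mem _ x)) ?_
  rw [← map_sub]
  exact (orthogonalSubrep hρ σ).apply_mem_toSubmodule g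
    (Submodule.sub_starProjection_mem_orthogonal x)

lemma exists_finset_isAtom_pairwise_isOrtho [FiniteDimensional 𝕜 E]
    (hρ : ∀ g v w, inner 𝕜 (ρ g v) (ρ g w) = inner 𝕜 v w) (σ : Subrepresentation ρ) :
    ∃ s : Finset (Subrepresentation ρ), (∀ α ∈ s, IsAtom α) ∧
      (s : Set (Subrepresentation ρ)).Pairwise (fun α β => α.toSubmodule ⟂ β.toSubmodule) ∧
      ⨆ α ∈ s, α.toSubmodule = σ.toSubmodule := by
  classical
  have hwf : WellFoundedLT (Subrepresentation ρ) :=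
    StrictMono.wellFoundedLT (f := Subrepresentation.toSubmodule) fun _ _ h => h
  have := isAtomic_of_orderBot_wellFounded_lt hwf.wf
  induction σ using WellFoundedLT.induction with | _ σ ih
  obtain rfl | ⟨α, hα, hασ⟩ := eq_bot_or_exists_atom_le σ
  · exact ⟨∅, by simp [show (⊥ : Subrepresentation ρ).toSubmodule = ⊥ from rfl]⟩
  have hlt : σ ⊓ orthogonalSubrep hρ α < σ := by
    refine inf_le_left.lt_of_ne fun h => hα.1 ?_
    have hself : α.toSubmodule ⟂ α.toSubmodule := hασ.trans (inf_eq_left.1 h)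
    exact Subrepresentation.toSubmodule_injective (Submodule.isOrtho_self.1 hself)
  obtain ⟨t, ht_atom, ht_ortho, ht_sup⟩ := ih _ hlt
  have hortho : ∀ β ∈ t, β.toSubmodule ⟂ α.toSubmodule := fun β hβ =>
    (le_biSup Subrepresentation.toSubmodule hβ).trans (ht_sup.trans_le inf_le_right)
  refine ⟨insert α t, by simpa using ⟨hα, ht_atom⟩, ?_, ?_⟩
  · rw [Finset.coe_insert, Set.pairwise_insert]
    exact ⟨ht_ortho, fun β hβ _ => ⟨(hortho β hβ).symm, hortho β hβ⟩⟩
  · rw [Finset.iSup_insert, ht_sup, inf_comm]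
    exact Submodule.sup_orthogonal_inf_of_hasOrthogonalProjection hασ

lemma exists_orthogonalFamily_isAtom [FiniteDimensional 𝕜 E]
    (hρ : ∀ g v w, inner 𝕜 (ρ g v) (ρ g w) = inner 𝕜 v w) :
    ∃ (m : ℕ) (W : Fin m → Subrepresentation ρ), (∀ j, IsAtom (W j)) ∧
      OrthogonalFamily 𝕜 (fun j => (W j).toSubmodule) (fun j => (W j).toSubmodule.subtypeₗᵢ) ∧
      DirectSum.IsInternal fun j => (W j).toSubmodule := by
  obtain ⟨s, hs_atom, hs_ortho, hs_sup⟩ := exists_finset_isAtom_pairwise_isOrtho hρ ⊤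
  set W : Fin s.card → Subrepresentation ρ := fun j => s.equivFin.symm j
  have hO : OrthogonalFamily 𝕜 (fun j => (W j).toSubmodule)
      (fun j => (W j).toSubmodule.subtypeₗᵢ) :=
    OrthogonalFamily.of_pairwise fun i j hij => hs_ortho (Subtype.prop _) (Subtype.prop _)
      fun h => hij (s.equivFin.symm.injective (Subtype.ext h))
  refine ⟨s.card, W, fun j => hs_atom _ (Subtype.prop _), hO, ?_⟩
  rw [hO.isInternal_iff, Submodule.orthogonal_eq_bot_iff,
    s.equivFin.symm.iSup_comp (g := fun α => α.1.toSubmodule),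
    iSup_subtype (f := fun α : s => α.1.toSubmodule), hs_sup]
  rfl

lemma isIrreducible_toRepresentation {σ : Subrepresentation ρ} (hσ : IsAtom σ) :
    σ.toRepresentation.IsIrreducible where
  exists_pair_ne := ⟨⊥, ⊤, fun h => hσ.1 <| Subrepresentation.toSubmodule_injective <|
    Submodule.subsingleton_iff_eq_bot.1 <| (Submodule.subsingleton_iff 𝕜).1 <|
      subsingleton_of_bot_eq_top (congrArg Subrepresentation.toSubmodule h)⟩
  eq_bot_or_eq_top τ := by
    set τ' : Subrepresentation ρ := ⟨τ.toSubmodule.map σ.toSubmodule.subtype, fun g v hv => by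
      obtain ⟨u, hu, rfl⟩ := hv
      exact ⟨_, τ.apply_mem_toSubmodule g hu, rfl⟩⟩
    have hinj := Submodule.map_injective_of_injective σ.toSubmodule.injective_subtype
    refine (hσ.le_iff.1 (show τ' ≤ σ from Submodule.map_subtype_le _ _)).imp
      (fun h => ?_) fun h => ?_ <;>
    refine Subrepresentation.toSubmodule_injective (hinj ?_)
    · exact (congrArg Subrepresentation.toSubmodule h).trans (Submodule.map_bot _).symm
    · exact (congrArg Subrepresentation.toSubmodule h).trans (Submodule.map_subtype_top _).symm

end Decomposition

/-! ### Fixed vectors in the constituents of the defining representation -/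

/-- The representation of a subgroup of `U(n)` on the Hilbert space `ℂⁿ`. -/
def definingRep (K : Subgroup (UGroup n)) : Representation ℂ K (EuclideanSpace ℂ (Fin n)) where
  toFun k := Matrix.toEuclideanLin ((k : UGroup n) : Matrix (Fin n) (Fin n) ℂ)
  map_one' := by
    ext x
    simp
  map_mul' k l := by
    ext x
    simp [Matrix.toLpLin_apply, Matrix.mulVec_mulVec]

lemma definingRep_apply {K : Subgroup (UGroup n)} (k : K) (x : EuclideanSpace ℂ (Fin n)) :
    definingRep K k x = WithLp.toLp 2 (act (k : UGroup n) x.ofLp) := rfl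

lemma inner_definingRep {K : Subgroup (UGroup n)} (k : K) (v w : EuclideanSpace ℂ (Fin n)) :
    inner ℂ (definingRep K k v) (definingRep K k w) = inner ℂ v w := by
  rw [definingRep_apply, definingRep_apply, inner_toLp_eq_herm, herm_act, ← inner_toLp_eq_herm]

lemma continuous_definingRep {K : Subgroup (UGroup n)} (x : EuclideanSpace ℂ (Fin n)) :
    Continuous fun k => definingRep K k x := by
  simp only [definingRep_apply, act]
  fun_prop

lemma mem_invariants_toRepresentation {K : Subgroup (UGroup n)} (M : Subgroup K)
    (σ : Subrepresentation (definingRep K)) (v : σ.toSubmodule) :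
    v ∈ Representation.invariants (σ.toRepresentation.comp M.subtype) ↔
      ∀ l ∈ M, definingRep K l v = v := by
  simp only [Representation.mem_invariants, Subtype.forall, Subtype.ext_iff]
  rfl

lemma finrank_invariants_eq_one {K : Subgroup (UGroup n)} {M : Subgroup K}
    (hdim : ClassOneDimOne K M)
    (hmeets : ∀ x, ∃ k, ∀ l ∈ M, definingRep K l (definingRep K k x) = definingRep K k x)
    {σ : Subrepresentation (definingRep K)} (hσ : IsAtom σ) :
    Module.finrank ℂ (Representation.invariants (σ.toRepresentation.comp M.subtype)) = 1 := by
  have hσ_dim := @hdim σ.toSubmodule _ _ _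
  refine hσ_dim σ.toRepresentation (fun k v w => inner_definingRep k v w)
    (fun v => Continuous.subtype_mk (continuous_definingRep v.1) _)
    (isIrreducible_toRepresentation hσ) ?_
  have hne : σ.toSubmodule ≠ ⊥ := fun h => hσ.1 (Subrepresentation.toSubmodule_injective h)
  obtain ⟨x, hx, hx0⟩ := Submodule.exists_mem_ne_zero_of_ne_bot hne
  obtain ⟨k, hk⟩ := hmeets x
  refine (Submodule.ne_bot_iff _).2 ⟨⟨definingRep K k x, σ.apply_mem_toSubmodule k hx⟩,
    (mem_invariants_toRepresentation M σ _).2 hk, fun h => hx0 ?_⟩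
  have h0 : definingRep K k x = 0 := congrArg Subtype.val h
  rw [← inner_self_eq_zero (𝕜 := ℂ), ← inner_definingRep k, h0, inner_zero_left]

lemma exists_exp_smul_eq_of_norm_smul_eq {V : Type*} [NormedAddCommGroup V] [NormedSpace ℂ V]
    {v : V} (hv : v ≠ 0) {c : ℂ} (hc : ‖v‖ = ‖c • v‖) :
    ∃ θ : ℝ, c • v = Complex.exp (θ * Complex.I) • v := by
  rw [norm_smul, eq_comm, mul_eq_right₀ (norm_ne_zero_iff.2 hv), Complex.norm_eq_one_iff] at hc
  obtain ⟨θ, rfl⟩ := hc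
  exact ⟨θ, rfl⟩

lemma exists_eq_exp_smul_of_forall_fixed {K : Subgroup (UGroup n)} {M : Subgroup K}
    (hdim : ClassOneDimOne K M)
    (hmeets : ∀ x, ∃ k, ∀ l ∈ M, definingRep K l (definingRep K k x) = definingRep K k x)
    {σ : Subrepresentation (definingRep K)} (hσ : IsAtom σ)
    {v w : EuclideanSpace ℂ (Fin n)} (hv : v ∈ σ.toSubmodule) (hw : w ∈ σ.toSubmodule)
    (hMv : ∀ l ∈ M, definingRep K l v = v) (hMw : ∀ l ∈ M, definingRep K l w = w)
    (hvw : ‖v‖ = ‖w‖) : ∃ θ : ℝ, w = Complex.exp (θ * Complex.I) • v := by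
  by_cases hv0 : v = 0
  · exact ⟨0, by rw [hv0, smul_zero, ← norm_eq_zero, ← hvw, hv0, norm_zero]⟩
  obtain ⟨c, hc⟩ := exists_smul_eq_of_finrank_eq_one (finrank_invariants_eq_one hdim hmeets hσ)
    (x := ⟨⟨v, hv⟩, (mem_invariants_toRepresentation M σ _).2 hMv⟩)
    (fun h => hv0 (congrArg (fun u => u.1.1) h))
    ⟨⟨w, hw⟩, (mem_invariants_toRepresentation M σ _).2 hMw⟩
  have hcv : c • v = w := congrArg (fun u => u.1.1) hc
  subst hcv
  exact exists_exp_smul_eq_of_norm_smul_eq hv0 hvw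

/-! ### Block diagonal unitary groups -/

section Blocks

variable {m : ℕ} (ν : Fin m → ℕ) (h : ∑ j, ν j = n)

/-- The index of the block of `U(ν₁) × ⋯ × U(ν_m)` containing the coordinate `c`. -/
def blockIndex (c : Fin n) : Fin m :=
  ((finSigmaFinEquiv.trans (finCongr h)).symm c).1

/-- The orthogonal projection of `ℂⁿ` onto the coordinates of the `j`-th block. -/
def blockProj (j : Fin m) : Matrix (Fin n) (Fin n) ℂ :=
  Matrix.diagonal fun c => (Pi.single j 1 : Fin m → ℂ) (blockIndex ν h c)

lemma completeOrthogonalIdempotents_blockProj : CompleteOrthogonalIdempotents (blockProj ν h) :=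
  (CompleteOrthogonalIdempotents.single fun _ : Fin m => ℂ).map
    ((Matrix.diagonalRingHom (Fin n) ℂ).comp
      (RingHom.pi fun c => Pi.evalRingHom (fun _ : Fin m => ℂ) (blockIndex ν h c)))

lemma isStarProjection_blockProj (j : Fin m) : IsStarProjection (blockProj ν h j) where
  isIdempotentElem := (completeOrthogonalIdempotents_blockProj ν h).idem j
  isSelfAdjoint := by
    refine Matrix.isHermitian_diagonal_iff.2 fun c => ?_
    obtain hc | hc := eq_or_ne (blockIndex ν h c) j
    · simp [hc]
    · simp [hc]

lemma forall_commute_blockProj_iff {B : Matrix (Fin n) (Fin n) ℂ} :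
    (∀ j, Commute (blockProj ν h j) B) ↔
      ∀ c d, blockIndex ν h c ≠ blockIndex ν h d → B c d = 0 := by
  simp only [commute_iff_eq, ← Matrix.ext_iff, blockProj, Matrix.diagonal_mul,
    Matrix.mul_diagonal]
  refine ⟨fun hB c d hcd => ?_, fun hB j c d => ?_⟩
  · simpa [Pi.single_apply, hcd.symm] using hB (blockIndex ν h c) c d
  · by_cases hcd : blockIndex ν h c = blockIndex ν h d
    · rw [hcd, mul_comm]
    · rw [hB c d hcd, mul_zero, zero_mul]

lemma mem_unitaryGroup_of_blockDiagonal' {R ι : Type*} {κ : ι → Type*} [CommRing R] [StarRing R]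
    [Fintype ι] [DecidableEq ι] [∀ i, Fintype (κ i)] [∀ i, DecidableEq (κ i)]
    {D : ∀ i, Matrix (κ i) (κ i) R}
    (hD : Matrix.blockDiagonal' D ∈ Matrix.unitaryGroup (Σ i, κ i) R) (i : ι) :
    D i ∈ Matrix.unitaryGroup (κ i) R := by
  rw [Matrix.mem_unitaryGroup_iff, Matrix.star_eq_conjTranspose,
    Matrix.blockDiagonal'_conjTranspose, ← Matrix.blockDiagonal'_mul,
    ← Matrix.blockDiagonal'_one] at hD
  exact Matrix.mem_unitaryGroup_iff.2 (congrFun (Matrix.blockDiagonal'_injective hD) i)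

lemma mem_blockUnitary_iff {B : UGroup n} :
    B ∈ blockUnitary ν h ↔ ∀ c d, blockIndex ν h c ≠ blockIndex ν h d →
      (B : Matrix (Fin n) (Fin n) ℂ) c d = 0 := by
  constructor
  · rintro ⟨U, rfl⟩ c d hcd
    exact Matrix.blockDiagonal'_apply_ne
      (fun j => (U j : Matrix (Fin (ν j)) (Fin (ν j)) ℂ)) _ _ hcd
  intro hB
  set ι := finSigmaFinEquiv.trans (finCongr h) with hι
  set D := Matrix.blockDiag' (Matrix.reindex ι.symm ι.symm (B : Matrix (Fin n) (Fin n) ℂ))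
  have hBD : Matrix.blockDiagonal' D = Matrix.reindex ι.symm ι.symm B := by
    ext ⟨i, a⟩ ⟨j, b⟩
    obtain rfl | hij := eq_or_ne i j
    · exact Matrix.blockDiagonal'_apply_eq D i a b
    · rw [Matrix.blockDiagonal'_apply_ne _ _ _ hij]
      exact (hB _ _ (by simpa [blockIndex, ← hι] using hij)).symm
  have hD : Matrix.blockDiagonal' D ∈ Matrix.unitaryGroup (Σ j, Fin (ν j)) ℂ := by
    rw [hBD, Matrix.mem_unitaryGroup_iff, Matrix.star_eq_conjTranspose,
      Matrix.conjTranspose_reindex, Matrix.reindex_apply, Matrix.reindex_apply,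
      Matrix.submatrix_mul_equiv, ← Matrix.star_eq_conjTranspose, Unitary.mul_star_self_of_mem B.2,
      Matrix.submatrix_one_equiv]
  refine ⟨fun j => ⟨D j, mem_unitaryGroup_of_blockDiagonal' hD j⟩, Subtype.ext ?_⟩
  change Matrix.reindex ι ι (Matrix.blockDiagonal' D) = B
  rw [hBD]
  ext c d
  simp

lemma mem_blockUnitary_iff_commute {B : UGroup n} :
    B ∈ blockUnitary ν h ↔ ∀ j, Commute (blockProj ν h j) (B : Matrix (Fin n) (Fin n) ℂ) :=
  (mem_blockUnitary_iff ν h).trans (forall_commute_blockProj_iff ν h).symm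

end Blocks

section Frame

variable (J : UGroup n) {m : ℕ} (ν : Fin m → ℕ) (h : ∑ j, ν j = n)

/-- The orthogonal projection of `ℂⁿ` onto the span of the `j`-th block of columns of `J`. -/
def frameProj (j : Fin m) : Matrix (Fin n) (Fin n) ℂ :=
  Unitary.conjStarAlgAut ℂ _ J (blockProj ν h j)

lemma isStarProjection_frameProj (j : Fin m) : IsStarProjection (frameProj J ν h j) :=
  (isStarProjection_blockProj ν h j).map (Unitary.conjStarAlgAut ℂ _ J)

lemma completeOrthogonalIdempotents_frameProj :
    CompleteOrthogonalIdempotents (frameProj J ν h) :=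
  (completeOrthogonalIdempotents_blockProj ν h).map
    (RingHomClass.toRingHom (Unitary.conjStarAlgAut ℂ _ J))

lemma mem_conjSubgroup_blockUnitary_iff {u : UGroup n} :
    u ∈ conjSubgroup J (blockUnitary ν h) ↔
      ∀ j, Commute (frameProj J ν h j) (u : Matrix (Fin n) (Fin n) ℂ) := by
  have hconj : (u : Matrix (Fin n) (Fin n) ℂ) =
      Unitary.conjStarAlgAut ℂ _ J ((MulAut.conj J).symm u : UGroup n) :=
    congrArg Subtype.val ((MulAut.conj J).apply_symm_apply u).symm
  refine (Subgroup.mem_map_equiv (f := MulAut.conj J)).trans ?_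
  rw [mem_blockUnitary_iff_commute]
  refine forall_congr' fun j => ?_
  rw [hconj]
  exact (commute_map_iff (EquivLike.injective (Unitary.conjStarAlgAut ℂ _ J))).symm

lemma frameProj_mulVec_col (j : Fin m) (c : Fin n) :
    (frameProj J ν h j).mulVec ((J : Matrix (Fin n) (Fin n) ℂ).col c) =
      if blockIndex ν h c = j then (J : Matrix (Fin n) (Fin n) ℂ).col c else 0 := by
  have hJ : (star J : Matrix (Fin n) (Fin n) ℂ) * J = 1 := Unitary.coe_star_mul_self J
  rw [← Matrix.mulVec_single_one, Matrix.mulVec_mulVec, frameProj, Unitary.conjStarAlgAut_apply,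
    mul_assoc, hJ, mul_one, ← Matrix.mulVec_mulVec, blockProj, Matrix.diagonal_mulVec_single]
  split_ifs with hc <;> simp [hc]

end Frame

section AdaptedFrame

variable {m : ℕ} {W : Fin m → Submodule ℂ (EuclideanSpace ℂ (Fin n))}

lemma exists_orthonormalBasis_mem_of_isInternal
    (hO : OrthogonalFamily ℂ (fun j => W j) fun j => (W j).subtypeₗᵢ)
    (hI : DirectSum.IsInternal W) (hW : ∀ j, W j ≠ ⊥) :
    ∃ (ν : Fin m → ℕ) (h : ∑ j, ν j = n)
      (b : OrthonormalBasis (Fin n) ℂ (EuclideanSpace ℂ (Fin n))),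
      (∀ j, 0 < ν j) ∧ ∀ c, b c ∈ W (blockIndex ν h c) := by
  set b := hI.collectedOrthonormalBasis hO fun j => stdOrthonormalBasis ℂ (W j)
  have h : ∑ j, Module.finrank ℂ (W j) = n := by
    simpa using (Module.finrank_eq_card_basis b.toBasis).symm
  refine ⟨_, h, b.reindex (finSigmaFinEquiv.trans (finCongr h)), fun j => ?_, fun c => ?_⟩
  · exact Nat.pos_of_ne_zero fun h0 => hW j (Submodule.finrank_eq_zero.1 h0)
  · rw [OrthonormalBasis.reindex_apply]
    exact hI.collectedOrthonormalBasis_mem hO _ _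

lemma starProjection_eq_ite_of_mem
    (hO : OrthogonalFamily ℂ (fun j => W j) fun j => (W j).subtypeₗᵢ) {i : Fin m}
    {v : EuclideanSpace ℂ (Fin n)} (hv : v ∈ W i) (j : Fin m) :
    (W j).starProjection v = if i = j then v else 0 := by
  split_ifs with hij
  · exact Submodule.starProjection_eq_self_iff.2 (hij ▸ hv)
  · exact (Submodule.starProjection_apply_eq_zero_iff _).2 (hO.isOrtho hij hv)

lemma exists_frameProj_eq_starProjection
    (hO : OrthogonalFamily ℂ (fun j => W j) fun j => (W j).subtypeₗᵢ)
    (hI : DirectSum.IsInternal W) (hW : ∀ j, W j ≠ ⊥) :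
    ∃ (J : UGroup n) (ν : Fin m → ℕ) (h : ∑ j, ν j = n), (∀ j, 0 < ν j) ∧
      ∀ j z, WithLp.toLp 2 ((frameProj J ν h j).mulVec z) =
        (W j).starProjection (WithLp.toLp 2 z) := by
  obtain ⟨ν, h, b, hν, hb⟩ := exists_orthonormalBasis_mem_of_isInternal hO hI hW
  set J : UGroup n := ⟨(EuclideanSpace.basisFun (Fin n) ℂ).toBasis.toMatrix b,
    OrthonormalBasis.toMatrix_orthonormalBasis_mem_unitary _ _⟩
  have hJ : ∀ c, (J : Matrix (Fin n) (Fin n) ℂ).col c = (b c).ofLp := fun c => by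
    ext a
    simp [J, Module.Basis.toMatrix_apply]
  refine ⟨J, ν, h, hν, fun j z => ?_⟩
  suffices hmap : Matrix.toEuclideanLin (frameProj J ν h j) = (W j).starProjection from
    LinearMap.congr_fun hmap (WithLp.toLp 2 z)
  refine b.toBasis.ext fun c => ?_
  rw [b.coe_toBasis, Matrix.toLpLin_apply, ← hJ, frameProj_mulVec_col, hJ,
    ContinuousLinearMap.coe_coe, starProjection_eq_ite_of_mem hO (hb c)]
  split_ifs <;> rfl

end AdaptedFrame

section AdaptedToSubrepresentations

variable {K : Subgroup (UGroup n)} {M : Subgroup K} {J : UGroup n} {m : ℕ} {ν : Fin m → ℕ}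
  {h : ∑ j, ν j = n} {W : Fin m → Subrepresentation (definingRep K)}

lemma le_conjSubgroup_blockUnitary
    (hJ : ∀ j z, WithLp.toLp 2 ((frameProj J ν h j).mulVec z) =
      (W j).toSubmodule.starProjection (WithLp.toLp 2 z)) :
    K ≤ conjSubgroup J (blockUnitary ν h) := by
  refine fun k hk => (mem_conjSubgroup_blockUnitary_iff J ν h).2 fun j => ?_
  have hcomm : ∀ z,
      (frameProj J ν h j).mulVec (act k z) = act k ((frameProj J ν h j).mulVec z) := by
    intro z
    have hW := starProjection_apply_subrep inner_definingRep (W j) ⟨k, hk⟩ (WithLp.toLp 2 z)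
    rw [definingRep_apply, definingRep_apply, ← hJ, ← hJ] at hW
    exact WithLp.toLp_injective 2 hW
  simp only [act, Matrix.mulVec_mulVec] at hcomm
  exact Matrix.ext_iff_mulVec.2 hcomm

lemma frameProj_mulVec_act {u : UGroup n} (hu : u ∈ conjSubgroup J (blockUnitary ν h))
    (j : Fin m) (z : Fin n → ℂ) :
    (frameProj J ν h j).mulVec (act u z) = act u ((frameProj J ν h j).mulVec z) := by
  rw [act, act, Matrix.mulVec_mulVec, Matrix.mulVec_mulVec,
    ((mem_conjSubgroup_blockUnitary_iff J ν h).1 hu j).eq]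

lemma exists_frameProj_mulVec_eq_exp_smul (hdim : ClassOneDimOne K M)
    (hmeets : ∀ z, ∃ k ∈ K, ∀ l ∈ M, act (l : UGroup n) (act k z) = act k z)
    (hW : ∀ j, IsAtom (W j))
    (hJ : ∀ j z, WithLp.toLp 2 ((frameProj J ν h j).mulVec z) =
      (W j).toSubmodule.starProjection (WithLp.toLp 2 z)) {z z' : Fin n → ℂ}
    (hz : ∀ l ∈ M, act (l : UGroup n) z = z) (hz' : ∀ l ∈ M, act (l : UGroup n) z' = z')
    {j : Fin m} (hzz' : ‖WithLp.toLp 2 ((frameProj J ν h j).mulVec z)‖ =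
      ‖WithLp.toLp 2 ((frameProj J ν h j).mulVec z')‖) :
    ∃ θ : ℝ, (frameProj J ν h j).mulVec z' =
      Complex.exp (θ * Complex.I) • (frameProj J ν h j).mulVec z := by
  have hmem : ∀ x, WithLp.toLp 2 ((frameProj J ν h j).mulVec x) ∈ (W j).toSubmodule := fun x => by
    rw [hJ]
    exact Submodule.starProjection_apply_mem _ _
  have hfixed : ∀ x, (∀ l ∈ M, act (l : UGroup n) x = x) → ∀ l ∈ M,
      definingRep K l (WithLp.toLp 2 ((frameProj J ν h j).mulVec x)) =
        WithLp.toLp 2 ((frameProj J ν h j).mulVec x) := fun x hx l hl => by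
    rw [definingRep_apply, ← frameProj_mulVec_act (le_conjSubgroup_blockUnitary hJ l.2), hx l hl]
  have hmeets' : ∀ x, ∃ k, ∀ l ∈ M,
      definingRep K l (definingRep K k x) = definingRep K k x := fun x => by
    obtain ⟨k, hk, hfix⟩ := hmeets x.ofLp
    exact ⟨⟨k, hk⟩, fun l hl => congrArg (WithLp.toLp 2) (hfix l hl)⟩
  obtain ⟨θ, hθ⟩ := exists_eq_exp_smul_of_forall_fixed hdim hmeets' (hW j) (hmem z) (hmem z')
    (hfixed z hz) (hfixed z' hz') hzz'
  exact ⟨θ, WithLp.toLp_injective 2 hθ⟩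

end AdaptedToSubrepresentations

end PolarGelfand

end

open PolarGelfand in
theorem proposition10p2_general (n : ℕ) (K : Subgroup (UGroup n)) (M : Subgroup K)
    (hGelfand : IsGelfandPair K)
    (hmeets : ∀ z, ∃ k ∈ K, ∀ l ∈ M, act (l : UGroup n) (act k z) = act k z)
    (hdim : ClassOneDimOne K M) :
    ∃ (J : UGroup n) (m : ℕ) (ν : Fin m → ℕ) (h : ∑ j, ν j = n), (∀ j, 0 < ν j) ∧
      invariantPolynomials K = invariantPolynomials (conjSubgroup J (blockUnitary ν h)) := by
  obtain ⟨m, W, hW, hO, hI⟩ := exists_orthogonalFamily_isAtom (inner_definingRep (K := K))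
  obtain ⟨J, ν, h, hν, hJ⟩ := exists_frameProj_eq_starProjection hO hI fun j hj =>
    (hW j).1 (Subrepresentation.toSubmodule_injective hj)
  have hle : K ≤ conjSubgroup J (blockUnitary ν h) := le_conjSubgroup_blockUnitary hJ
  have hact : ∀ u ∈ conjSubgroup J (blockUnitary ν h), ∀ j z,
      ‖WithLp.toLp 2 ((frameProj J ν h j).mulVec (act u z))‖ =
        ‖WithLp.toLp 2 ((frameProj J ν h j).mulVec z)‖ := fun u hu j z => by
    rw [frameProj_mulVec_act hu, norm_toLp_act]
  refine ⟨J, m, ν, h, hν, le_antisymm (fun p hp u hu z => ?_) fun p hp k hk => hp k (hle hk)⟩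
  obtain ⟨k, hk, hfix⟩ := hmeets z
  obtain ⟨k', hk', hfix'⟩ := hmeets (act u z)
  choose θ hθ using fun j => exists_frameProj_mulVec_eq_exp_smul hdim hmeets hW hJ hfix hfix'
    (j := j) (by rw [hact k (hle hk), hact k' (hle hk'), hact u hu])
  rw [← hp k hk z, ← hp k' hk' (act u z)]
  have hcommute : ∀ j, ∀ k ∈ K, Commute (frameProj J ν h j) k := fun j k hk =>
    (mem_conjSubgroup_blockUnitary_iff J ν h).1 (hle hk) j
  exact eq_of_forall_mulVec_eq_exp_smul (completeOrthogonalIdempotents_frameProj J ν h)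
    ((contDiff_evalAt p).differentiable one_ne_zero)
    (fun j => fderiv_I_smul_mulVec_eq_zero hGelfand (isStarProjection_frameProj J ν h j)
      (hcommute j) (contDiff_evalAt p) hp) hθ

theorem proposition10p2 (n : ℕ) (K : Subgroup (PolarGelfand.UGroup n))
    (hcompact : IsCompact (K : Set (PolarGelfand.UGroup n)))
    (hconnected : IsConnected (K : Set (PolarGelfand.UGroup n)))
    (hGelfand : PolarGelfand.IsGelfandPair K)
    (T : Submodule ℝ (Fin n → ℂ)) (hT : PolarGelfand.IsTransversalDomain K T)
    (hdim : PolarGelfand.ClassOneDimOne K (PolarGelfand.stabilizer K T)) :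
    ∃ (J : PolarGelfand.UGroup n) (m : ℕ) (ν : Fin m → ℕ) (h : ∑ j, ν j = n),
      (∀ j, 0 < ν j) ∧
      PolarGelfand.invariantPolynomials K =
        PolarGelfand.invariantPolynomials
          (PolarGelfand.conjSubgroup J (PolarGelfand.blockUnitary ν h)) :=
  proposition10p2_general n K (PolarGelfand.stabilizer K T) hGelfand
    (fun z => (hT.meets z).imp fun _ hk => ⟨hk.1, fun _ hl => hl _ hk.2⟩) hdim
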